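/- Let $\mathcal C$ be a category with finite limits. A pushout square in $\mathcal C$ is called stable if its pullback along every morphism into its vertex (the pushout object) is again a pushout square. A Mal'cev span is a jointly monic span $f\colon A\leftarrow R\rightarrow B\colon g$ for which there is a morphism $m\colon R\times_B R\times_A R\to R$ with $f m=f\pi_1$ and $g m=g\pi_3$, where $R\times_B R\times_A R$ is the universal object with projections $\pi_1,\pi_2,\pi_3$ to $R$ satisfying $g\pi_1=g\pi_2$ and $f\pi_2=f\pi_3$. The following are equivalent: (i) $\mathcal C$ is diexact: every Mal'cev span in $\mathcal C$ has a pushout, and every such pushout square is stable and is itself a pullback square; (ii) $\mathcal C$ is Barr-exact (that is, $\mathcal C$ is regular and every equivalence relation in $\mathcal C$ is a kernel pair) and adhesive, in the sense that every span with at least one monic leg has a pushout, and every such pushout square is stable and is itself a pullback square; (iii) $\mathcal C$ is Barr-exact and amalgamable: every span of monomorphisms in $\mathcal C$ has a pushout which is stable and is itself a pullback square. -/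

import Mathlib

open CategoryTheory CategoryTheory.Limits

universe v u

namespace Exactness

variable {C : Type u} [Category.{v} C]

/-- A commutative square `f ≫ h = g ≫ i` is a *stable pushout* if it is a pushout and its pullback
along any morphism `t : Z' ⟶ Z` into its vertex is again a pushout. The pullback of the square is
presented as the top face of a commutative cube whose four vertical faces are pullbacks. -/
structure IsStablePushout {W X Y Z : C} (f : W ⟶ X) (g : W ⟶ Y) (h : X ⟶ Z) (i : Y ⟶ Z) :
    Prop where
  isPushout : IsPushout f g h i
  isPushout_of_isPullback : ∀ ⦃W' X' Y' Z' : C⦄ (f' : W' ⟶ X') (g' : W' ⟶ Y') (h' : X' ⟶ Z')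
    (i' : Y' ⟶ Z') (w : W' ⟶ W) (x : X' ⟶ X) (y : Y' ⟶ Y) (t : Z' ⟶ Z),
    CommSq f' g' h' i' →
    IsPullback h' x t h → IsPullback i' y t i → IsPullback f' w x f → IsPullback g' w y g →
    IsPushout f' g' h' i'

/-- The span `f : W ⟶ X`, `g : W ⟶ Y` admits a pushout, and its pushout squares are stable under
pullback and are themselves pullback squares. -/
structure HasExactPushout {W X Y : C} (f : W ⟶ X) (g : W ⟶ Y) : Prop where
  hasPushout : HasPushout f g
  isStablePushout : ∀ ⦃Z : C⦄ (h : X ⟶ Z) (i : Y ⟶ Z), IsPushout f g h i →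
    IsStablePushout f g h i
  isPullback : ∀ ⦃Z : C⦄ (h : X ⟶ Z) (i : Y ⟶ Z), IsPushout f g h i → IsPullback f g h i

/-- A *Mal'cev span* `A ⟵ R ⟶ B` is a jointly monic span `(f, g)` such that the span
`(π₁ ≫ f, π₃ ≫ g)` on `R ×_B R ×_A R` factors through `(f, g)`. The triple fibre product is formed
as the pullback of `π₂ ≫ f : R ×_B R ⟶ A` and `f : R ⟶ A`. -/
structure IsMalcevSpan [HasPullbacks C] {R A B : C} (f : R ⟶ A) (g : R ⟶ B) : Prop where
  jointlyMono : JointlyMono₂ f g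
  exists_factorisation : ∃ m : pullback (pullback.snd g g ≫ f) f ⟶ R,
    m ≫ f = (pullback.fst (pullback.snd g g ≫ f) f ≫ pullback.fst g g) ≫ f ∧
    m ≫ g = pullback.snd (pullback.snd g g ≫ f) f ≫ g

variable (C)

/-- A finitely complete category is *diexact* if Mal'cev spans have pushouts, which are stable under
pullback and are themselves pullbacks. -/
def IsDiexact [HasFiniteLimits C] : Prop :=
  ∀ ⦃R A B : C⦄ (f : R ⟶ A) (g : R ⟶ B), IsMalcevSpan f g → HasExactPushout f g

/-- A category is *Barr-exact* if it is regular and every internal equivalence relation is the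
kernel pair of some morphism. -/
structure IsBarrExact : Prop where
  regular : Regular C
  isKernelPair : ∀ ⦃R A : C⦄ (s t : R ⟶ A), IsEquivalenceRelation s t →
    ∃ (B : C) (q : A ⟶ B), IsKernelPair q s t

/-- A finitely complete category is *adhesive* if it has pushouts along monomorphisms, which are
stable under pullback and are themselves pullbacks. -/
def IsAdhesive [HasFiniteLimits C] : Prop :=
  ∀ ⦃W X Y : C⦄ (f : W ⟶ X) (g : W ⟶ Y), Mono f → HasExactPushout f g

/-- A finitely complete category is *amalgamable* if spans of monomorphisms have pushouts, which are
stable under pullback and are themselves pullbacks. -/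
def IsAmalgamable [HasFiniteLimits C] : Prop :=
  ∀ ⦃W X Y : C⦄ (f : W ⟶ X) (g : W ⟶ Y), Mono f → Mono g → HasExactPushout f g

end Exactness

/-!
The argument is carried out with generalized elements, as if in a category of sheaves: a property of
elements holds *locally* if it holds on a covering sieve of the canonical topology (`Locally`). As
representables are sheaves for this topology, equations between morphisms and factorizations through
monomorphisms may be checked locally, and locally defined morphisms glue. Regular epimorphisms of a
regular category are local surjections, and the legs of any stable pushout are jointly locally
surjective.

A diexact category is Barr-exact and adhesive because spans with a monic leg and equivalence
relations are Mal'cev spans. The pushout of an equivalence relation is a coequalizer, since the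
relation is reflexive, and its stability gives stability of regular epimorphisms.

Conversely, let `A ⟵ R ⟶ B` be a Mal'cev span in a Barr-exact amalgamable category. If there is an
exact pushout `P`, the kernel pair of `A ⟶ P` has to be the union of the diagonal with the image of
`R ×_B R`. This union exists (`IsAmalgamable.exists_linked_representation`), because the pushout of
two subobjects over their intersection is again a subobject
(`IsStablePushout.mono_of_isPullback`), and it is an equivalence relation because the span is Mal'cev
(`Linked.trans`). Let `A ⟶ P₁` and `B ⟶ P₂` be the resulting quotients. The morphisms `R ⟶ P₁` and
`R ⟶ P₂` have the same kernel pair (`Linked.swap`), hence the same image `Q`, and the amalgam of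
`P₁ ⟵ Q ⟶ P₂` is the pushout (`IsBarrExact.isDiexact`). That it is a stable pushout and a pullback
is read off from its local description `IsLocallyExact`, which is visibly stable under pullback.
-/

namespace Exactness

variable {C : Type u} [Category.{v} C]

/-! ### Local properties of generalized elements -/

/-- `Locally p` says that a property `p` of generalized elements `U ⟶ V` of `V` holds on a covering
sieve of `V` for the canonical topology. -/
def Locally {V : C} (p : ∀ ⦃U : C⦄, (U ⟶ V) → Prop) : Prop :=
  ∃ S ∈ Sheaf.canonicalTopology C V, ∀ ⦃U : C⦄ (k : U ⟶ V), S k → p k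

/-- A sieve is canonically covering as soon as its matching families with values in any object glue
uniquely, stably under pullback. -/
lemma mem_canonicalTopology {X : C} (S : Sieve X)
    (hS : ∀ ⦃V : C⦄ (p : V ⟶ X) (T : C) (φ : ∀ ⦃U : C⦄ (k : U ⟶ V), S (k ≫ p) → (U ⟶ T)),
      (∀ ⦃U W : C⦄ (l : W ⟶ U) (k : U ⟶ V) (hk : S (k ≫ p)) (hlk : S ((l ≫ k) ≫ p)),
        l ≫ φ k hk = φ (l ≫ k) hlk) →
      ∃! t : V ⟶ T, ∀ ⦃U : C⦄ (k : U ⟶ V) (hk : S (k ≫ p)), k ≫ t = φ k hk) :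
    S ∈ Sheaf.canonicalTopology C X := by
  apply Sheaf.mem_finestTopology_of_forall_isSheafFor
  rintro _ ⟨T, rfl⟩ V p x hx
  obtain ⟨t, ht, hu⟩ := hS p T (fun U k hk ↦ x k hk) (fun U W l k hk hlk ↦ by
    rw [Presieve.compatible_iff_sieveCompatible] at hx
    exact (hx k l hk).symm)
  exact ⟨t, fun U k hk ↦ ht k hk, fun s hs ↦ hu s fun U k hk ↦ hs k hk⟩

namespace Locally

variable {V : C} {p q : ∀ ⦃U : C⦄, (U ⟶ V) → Prop}

lemma of_forall (h : ∀ ⦃U : C⦄ (k : U ⟶ V), p k) : Locally p :=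
  ⟨⊤, GrothendieckTopology.top_mem _ _, fun _ k _ ↦ h k⟩

lemma mono (h : Locally p) (hpq : ∀ ⦃U : C⦄ (k : U ⟶ V), p k → q k) : Locally q :=
  let ⟨S, hS, hp⟩ := h
  ⟨S, hS, fun _ k hk ↦ hpq k (hp k hk)⟩

lemma restrict (h : Locally p) {W : C} (l : W ⟶ V) : Locally fun _ k ↦ p (k ≫ l) :=
  let ⟨S, hS, hp⟩ := h
  ⟨S.pullback l, GrothendieckTopology.pullback_stable _ l hS, fun _ k hk ↦ hp (k ≫ l) hk⟩

/-- What holds locally on the members of a covering sieve holds locally. -/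
lemma bind (h : Locally p)
    (hpq : ∀ ⦃U : C⦄ (k : U ⟶ V), p k → Locally fun _ l ↦ q (l ≫ k)) : Locally q := by
  obtain ⟨S, hS, hp⟩ := h
  choose R hR hq using fun (U : C) (k : U ⟶ V) (hk : S k) ↦ hpq k (hp k hk)
  refine ⟨Sieve.bind S.arrows fun U k hk ↦ R U k hk,
    GrothendieckTopology.bind_covering _ hS fun U k hk ↦ hR U k hk, ?_⟩
  rintro U _ ⟨W, l, k, hk, hl, rfl⟩
  exact hq W k hk l hl

/-- Generalized elements which agree locally are equal. -/
lemma hom_ext {T : C} {a b : V ⟶ T} (h : Locally fun _ k ↦ k ≫ a = k ≫ b) : a = b := by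
  obtain ⟨S, hS, hp⟩ := h
  exact ((Sheaf.isSheaf_yoneda_obj T) S hS).isSeparatedFor.ext fun U k hk ↦ hp k hk

/-- Locally defined morphisms to `T` glue. The local values are those selected by a predicate `r`
which is stable under restriction and has at most one value over each generalized element. -/
lemma glue {T : C} (r : ∀ ⦃U : C⦄, (U ⟶ V) → (U ⟶ T) → Prop)
    (hr : ∀ ⦃U W : C⦄ (l : W ⟶ U) (k : U ⟶ V) (t : U ⟶ T), r k t → r (l ≫ k) (l ≫ t))
    (huniq : ∀ ⦃U : C⦄ (k : U ⟶ V) (t t' : U ⟶ T), r k t → r k t' → t = t')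
    (h : Locally fun _ k ↦ ∃ t, r k t) :
    ∃ t : V ⟶ T, Locally fun _ k ↦ r k (k ≫ t) := by
  obtain ⟨S, hS, hp⟩ := h
  choose φ hφ using hp
  let x : Presieve.FamilyOfElements (yoneda.obj T) S.arrows := fun U k hk ↦ φ k hk
  have hc : x.Compatible := by
    rw [Presieve.compatible_iff_sieveCompatible]
    intro U W k l hk
    exact huniq (l ≫ k) _ _ (hφ _ _) (hr l k _ (hφ k hk))
  obtain ⟨t, ht, -⟩ := (Sheaf.isSheaf_yoneda_obj T) S hS x hc
  refine ⟨t, S, hS, fun U k hk ↦ ?_⟩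
  have : k ≫ t = φ k hk := ht k hk
  simpa only [this] using hφ k hk

/-- Factoring through a monomorphism is a local property. -/
lemma exists_factor {T Z : C} {a : V ⟶ Z} {m : T ⟶ Z} [Mono m]
    (h : Locally fun _ k ↦ ∃ t, t ≫ m = k ≫ a) : ∃ t, t ≫ m = a := by
  obtain ⟨t, ht⟩ := glue (fun U k (t : U ⟶ T) ↦ t ≫ m = k ≫ a)
    (fun U W l k t h ↦ by simp [h]) (fun U k t t' h h' ↦ by simp [← cancel_mono m, h, h']) h
  exact ⟨t, hom_ext (ht.mono fun U k hk ↦ by simpa using hk)⟩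

end Locally

/-- Regular epimorphisms in a regular category are local surjections. -/
lemma locally_lift_of_isRegularEpi [Regular C] {X Z : C} (e : X ⟶ Z) [IsRegularEpi e] {V : C}
    (p : V ⟶ Z) : Locally fun _ k ↦ ∃ x, x ≫ e = k ≫ p := by
  let S : Sieve Z := ⟨fun U k ↦ ∃ x : U ⟶ X, x ≫ e = k, by
    rintro U W _ ⟨x, rfl⟩ l
    exact ⟨l ≫ x, by simp⟩⟩
  refine ⟨S.pullback p, GrothendieckTopology.pullback_stable _ p (mem_canonicalTopology S ?_),
    fun U k hk ↦ hk⟩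
  intro V p T φ hφ
  let e' := pullback.fst p e
  have he : S (e' ≫ p) := ⟨pullback.snd p e, pullback.condition.symm⟩
  have hw : IsRegularEpi.left e' ≫ φ e' he = IsRegularEpi.right e' ≫ φ e' he := by
    have hl : ∀ {U : C} (l : U ⟶ _), S ((l ≫ e') ≫ p) := fun l ↦ by
      simpa using S.downward_closed he l
    rw [hφ _ _ _ (hl _), hφ _ _ _ (hl _)]
    simp only [IsRegularEpi.w]
  have hepi : Epi e' := inferInstance
  refine ⟨IsRegularEpi.desc e' (φ e' he) hw, ?_, ?_⟩
  · rintro U k ⟨x, hx⟩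
    have hk : k = pullback.lift k x hx.symm ≫ e' :=
      (pullback.lift_fst _ _ _).symm
    have hk' : S ((pullback.lift k x hx.symm ≫ e') ≫ p) := hk ▸ ⟨x, hx⟩
    calc k ≫ _ = pullback.lift k x hx.symm ≫ e' ≫ IsRegularEpi.desc e' (φ e' he) hw := by
          rw [← Category.assoc, ← hk]
      _ = φ (pullback.lift k x hx.symm ≫ e') hk' := by
          rw [IsRegularEpi.fac, hφ _ _ _ hk']
      _ = _ := by congr 1; exact hk.symm
  · intro t ht
    rw [← cancel_epi e', ht e' he, IsRegularEpi.fac]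

/-- The pullback of a stable pushout can be formed starting from its legs. -/
lemma IsStablePushout.exists_isPushout [HasPullbacks C] {W X Y Z : C} {f : W ⟶ X} {g : W ⟶ Y}
    {h : X ⟶ Z} {i : Y ⟶ Z} (H : IsStablePushout f g h i) {X' Y' Z' : C} {h' : X' ⟶ Z'}
    {i' : Y' ⟶ Z'} {x : X' ⟶ X} {y : Y' ⟶ Y} {t : Z' ⟶ Z} (hh : IsPullback h' x t h)
    (hi : IsPullback i' y t i) :
    ∃ (W' : C) (f' : W' ⟶ X') (g' : W' ⟶ Y'), IsPushout f' g' h' i' := by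
  have hf := IsPullback.of_hasPullback x f
  have hw : (pullback.fst x f ≫ h') ≫ t = (pullback.snd x f ≫ g) ≫ i := by
    simp [hh.w, ← H.isPushout.w, pullback.condition_assoc]
  have hg : IsPullback (hi.lift _ _ hw) (pullback.snd x f) y g :=
    .of_right' (by simpa [H.isPushout.w] using hf.paste_horiz hh) hi
  exact ⟨_, _, _, H.isPushout_of_isPullback _ _ _ _ _ _ _ t ⟨by simp⟩ hh hi hf hg⟩

/-- The legs of a stable pushout are jointly locally surjective. -/
lemma IsStablePushout.locally_lift [HasPullbacks C] {W X Y Z : C} {f : W ⟶ X} {g : W ⟶ Y}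
    {h : X ⟶ Z} {i : Y ⟶ Z} (H : IsStablePushout f g h i) {V : C} (p : V ⟶ Z) :
    Locally fun _ k ↦ (∃ x, x ≫ h = k ≫ p) ∨ ∃ y, y ≫ i = k ≫ p := by
  let S : Sieve Z := ⟨fun U k ↦ (∃ x : U ⟶ X, x ≫ h = k) ∨ ∃ y : U ⟶ Y, y ≫ i = k, by
    rintro U W _ (⟨x, rfl⟩ | ⟨x, rfl⟩) l
    · exact .inl ⟨l ≫ x, by simp⟩
    · exact .inr ⟨l ≫ x, by simp⟩⟩
  refine ⟨S.pullback p, GrothendieckTopology.pullback_stable _ p (mem_canonicalTopology S ?_),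
    fun U k hk ↦ hk⟩
  intro V p T φ hφ
  have hh := IsPullback.of_hasPullback p h
  have hi := IsPullback.of_hasPullback p i
  obtain ⟨W', f', g', hpo⟩ := H.exists_isPushout hh hi
  have hX : S (pullback.fst p h ≫ p) := .inl ⟨pullback.snd p h, pullback.condition.symm⟩
  have hY : S (pullback.fst p i ≫ p) := .inr ⟨pullback.snd p i, pullback.condition.symm⟩
  have hlX : ∀ {U : C} (l : U ⟶ _), S ((l ≫ pullback.fst p h) ≫ p) := fun l ↦ by
    simpa using S.downward_closed hX l
  have hlY : ∀ {U : C} (l : U ⟶ _), S ((l ≫ pullback.fst p i) ≫ p) := fun l ↦ by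
    simpa using S.downward_closed hY l
  have hc : f' ≫ φ _ hX = g' ≫ φ _ hY := by
    rw [hφ _ _ _ (hlX _), hφ _ _ _ (hlY _)]
    congr 1
    exact hpo.w
  refine ⟨hpo.desc _ _ hc, ?_, ?_⟩
  · rintro U k (⟨x, hx⟩ | ⟨x, hx⟩)
    · obtain ⟨l, rfl, -⟩ := hh.exists_lift k x hx.symm
      rw [Category.assoc, hpo.inl_desc, hφ]
    · obtain ⟨l, rfl, -⟩ := hi.exists_lift k x hx.symm
      rw [Category.assoc, hpo.inr_desc, hφ]
  · intro t ht
    apply hpo.hom_ext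
    · rw [ht _ hX, hpo.inl_desc]
    · rw [ht _ hY, hpo.inr_desc]

/-! ### Mal'cev spans and diexact categories -/

section Malcev

variable [HasPullbacks C] {R A B : C} {f : R ⟶ A} {g : R ⟶ B}

lemma isMalcevSpan_of_forall (hm : JointlyMono₂ f g)
    (h : ∀ ⦃V : C⦄ (r₁ r₂ r₃ : V ⟶ R), r₁ ≫ g = r₂ ≫ g → r₂ ≫ f = r₃ ≫ f →
      ∃ m : V ⟶ R, m ≫ f = r₁ ≫ f ∧ m ≫ g = r₃ ≫ g) : IsMalcevSpan f g where
  jointlyMono := hm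
  exists_factorisation := h _ (pullback.fst (pullback.snd g g ≫ f) f ≫ pullback.snd g g) _
    (by simp [pullback.condition]) (by simpa using pullback.condition)

lemma IsMalcevSpan.exists_of_eq (H : IsMalcevSpan f g) {V : C} (r₁ r₂ r₃ : V ⟶ R)
    (h₁₂ : r₁ ≫ g = r₂ ≫ g) (h₂₃ : r₂ ≫ f = r₃ ≫ f) :
    ∃ m : V ⟶ R, m ≫ f = r₁ ≫ f ∧ m ≫ g = r₃ ≫ g := by
  obtain ⟨m, hf, hg⟩ := H.exists_factorisation
  obtain ⟨k, rfl, rfl⟩ := (IsPullback.of_hasPullback g g).exists_lift r₁ r₂ h₁₂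
  obtain ⟨l, rfl, rfl⟩ := (IsPullback.of_hasPullback (pullback.snd g g ≫ f) f).exists_lift k r₃
    (by simpa using h₂₃)
  exact ⟨l ≫ m, by simp [hf], by simp [hg]⟩

lemma IsMalcevSpan.flip (H : IsMalcevSpan f g) : IsMalcevSpan g f :=
  isMalcevSpan_of_forall ⟨fun _ a b h₁ h₂ ↦ H.jointlyMono.right_cancellation a b h₂ h₁⟩
    fun _ r₁ r₂ r₃ h₁₂ h₂₃ ↦
      let ⟨m, hf, hg⟩ := H.exists_of_eq r₃ r₂ r₁ h₂₃.symm h₁₂.symm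
      ⟨m, hg, hf⟩

lemma isMalcevSpan_of_mono [Mono f] : IsMalcevSpan f g :=
  isMalcevSpan_of_forall ⟨fun _ a b h _ ↦ (cancel_mono f).1 h⟩ fun _ r₁ r₂ r₃ h₁₂ h₂₃ ↦
    ⟨r₁, rfl, by rw [h₁₂, (cancel_mono f).1 h₂₃]⟩

/-- Equivalence relations are Mal'cev spans: `a ~ b`, `c ~ b` and `c ~ d` imply `a ~ d`. -/
lemma isMalcevSpan_of_isEquivalenceRelation {s t : R ⟶ A} (H : IsEquivalenceRelation s t) :
    IsMalcevSpan s t := by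
  obtain ⟨E⟩ := H.nonempty_equivalenceRelation
  have trans : ∀ ⦃V : C⦄ (a b : V ⟶ R), a ≫ t = b ≫ s → ∃ c : V ⟶ R, c ≫ s = a ≫ s ∧
      c ≫ t = b ≫ t := fun V a b h ↦
    by
      obtain ⟨l, rfl, rfl⟩ := PullbackCone.IsLimit.lift' E.isLimit a b h
      exact ⟨l ≫ E.t, by rw [Category.assoc, E.transitivity₁, Category.assoc],
        by rw [Category.assoc, E.transitivity₂, Category.assoc]⟩
  refine isMalcevSpan_of_forall E.toJointlyMono₂ fun V r₁ r₂ r₃ h₁₂ h₂₃ ↦ ?_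
  obtain ⟨c, hcs, hct⟩ := trans r₁ (r₂ ≫ E.s) (by rw [Category.assoc, E.symmetry₁, h₁₂])
  obtain ⟨d, hds, hdt⟩ := trans c r₃ (by rw [hct, Category.assoc, E.symmetry₂, h₂₃])
  exact ⟨d, hds.trans hcs, hdt⟩

end Malcev

/-- The two legs of a pushout of a reflexive pair coincide, so that it is a coequalizer. -/
lemma isPushout_self_of_reflexive {R A Z : C} {s t : R ⟶ A} {h i : A ⟶ Z} (H : IsPushout s t h i)
    {r : A ⟶ R} (hs : r ≫ s = 𝟙 A) (ht : r ≫ t = 𝟙 A) : IsPushout s t h h := by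
  have : h = i := by simpa [reassoc_of% hs, reassoc_of% ht] using r ≫= H.w
  rwa [← this] at H

lemma isRegularEpi_of_isPushout_self {R A Z : C} {s t : R ⟶ A} {q : A ⟶ Z}
    (H : IsPushout s t q q) : IsRegularEpi q :=
  ⟨⟨Cofork.IsColimit.regularEpi H.isLimitFork⟩⟩

/-- Conversely to `isPushout_self_of_reflexive`, the coequalizer of a kernel pair is its pushout. -/
lemma _root_.CategoryTheory.IsKernelPair.isPushout {R A Z : C} {s t : R ⟶ A} {q : A ⟶ Z}
    [IsRegularEpi q] (H : IsKernelPair q s t) {r : A ⟶ R} (hs : r ≫ s = 𝟙 A) (ht : r ≫ t = 𝟙 A) :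
    IsPushout s t q q := by
  refine ⟨⟨H.w⟩, ⟨PushoutCocone.isColimitAux' _ fun c ↦ ?_⟩⟩
  have hc : c.inl = c.inr := by
    simpa [reassoc_of% hs, reassoc_of% ht] using r ≫= c.condition
  have hw : s ≫ c.inl = t ≫ c.inl := by rw [c.condition, hc]
  refine ⟨Cofork.IsColimit.desc H.toCoequalizer' c.inl hw, ?_, ?_, ?_⟩
  · exact Cofork.IsColimit.π_desc' H.toCoequalizer' c.inl hw
  · exact (Cofork.IsColimit.π_desc' H.toCoequalizer' c.inl hw).trans hc
  · intro m hm _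
    refine Cofork.IsColimit.hom_ext H.toCoequalizer' ?_
    exact hm.trans (Cofork.IsColimit.π_desc' H.toCoequalizer' c.inl hw).symm

section FiniteLimits

variable [HasFiniteLimits C]

lemma _root_.CategoryTheory.IsKernelPair.isEquivalenceRelation {R A Z : C} {s t : R ⟶ A}
    {q : A ⟶ Z} (H : IsKernelPair q s t) : IsEquivalenceRelation s t :=
  (H.equivalenceRelation q s t (pullbackIsPullback t s)).isEquivalenceRelation

lemma IsDiexact.isAdhesive (H : IsDiexact C) : IsAdhesive C :=
  fun _ _ _ f g _ ↦ H f g isMalcevSpan_of_mono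

/-- In a diexact category, the pushout of an equivalence relation `(s, t)` is a coequalizer `(q, q)`
having `(s, t)` as kernel pair. -/
lemma IsDiexact.exists_quotient (H : IsDiexact C) {R A : C} {s t : R ⟶ A}
    (hst : IsEquivalenceRelation s t) :
    ∃ (B : C) (q : A ⟶ B), IsPushout s t q q ∧ IsKernelPair q s t := by
  have hp := H s t (isMalcevSpan_of_isEquivalenceRelation hst)
  obtain ⟨E⟩ := hst.nonempty_equivalenceRelation
  have := hp.hasPushout
  have hq := isPushout_self_of_reflexive (.of_hasPushout s t) E.reflexivity₁ E.reflexivity₂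
  exact ⟨_, _, hq, hp.isPullback _ _ hq⟩

lemma IsDiexact.isBarrExact (H : IsDiexact C) : IsBarrExact C where
  regular :=
    { hasCoequalizer_of_isKernelPair h := by
        obtain ⟨B, q, hq, -⟩ := H.exists_quotient h.isEquivalenceRelation
        exact ⟨⟨_, hq.isLimitFork⟩⟩
      regularEpiIsStableUnderBaseChange := by
        refine ⟨fun {B' A A' B t q x q'} sq hq ↦ ?_⟩
        have : IsRegularEpi q := hq
        -- The kernel pair of `q` is a Mal'cev span with pushout `(q, q)`, which is therefore stable.
        have hk := IsKernelPair.of_hasPullback q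
        have hpo := hk.isPushout (hk.lift_fst (𝟙 _) (𝟙 _) rfl) (hk.lift_snd _ _ rfl)
        have hst := (H _ _ (isMalcevSpan_of_isEquivalenceRelation
          hk.isEquivalenceRelation)).isStablePushout _ _ hpo
        obtain ⟨_, _, _, h⟩ := hst.exists_isPushout sq.flip sq.flip
        exact isRegularEpi_of_isPushout_self h }
  isKernelPair _ _ _ _ hst :=
    let ⟨B, q, _, hq⟩ := H.exists_quotient hst
    ⟨B, q, hq⟩

end FiniteLimits

/-! ### Locally exact squares -/

/-- `Linked f g a a'` says that the generalized elements `a, a'` of `A` are locally equal or locally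
related by `R ×_B R`. For a Mal'cev span `A ⟵ R ⟶ B` this is the equivalence relation on `A` that
must become the kernel pair of the leg `A ⟶ P` of its pushout. -/
def Linked {R A B V : C} (f : R ⟶ A) (g : R ⟶ B) (a a' : V ⟶ A) : Prop :=
  Locally fun U (k : U ⟶ V) ↦ k ≫ a = k ≫ a' ∨
    ∃ r r' : U ⟶ R, r ≫ f = k ≫ a ∧ r' ≫ f = k ≫ a' ∧ r ≫ g = r' ≫ g

/-- A description by generalized elements of the squares which are pushouts of a Mal'cev span: the
legs of the cospan are jointly locally surjective, the square is locally a pullback, and the kernel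
pairs of `h` and `i` are generated by `R`. -/
structure IsLocallyExact {R A B P : C} (f : R ⟶ A) (g : R ⟶ B) (h : A ⟶ P) (i : B ⟶ P) :
    Prop where
  w : f ≫ h = g ≫ i
  locally_lift : ∀ ⦃V : C⦄ (p : V ⟶ P),
    Locally fun _ k ↦ (∃ a, a ≫ h = k ≫ p) ∨ ∃ b, b ≫ i = k ≫ p
  locally_exists : ∀ ⦃V : C⦄ (a : V ⟶ A) (b : V ⟶ B), a ≫ h = b ≫ i →
    Locally fun _ k ↦ ∃ r, r ≫ f = k ≫ a ∧ r ≫ g = k ≫ b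
  linked_left : ∀ ⦃V : C⦄ (a a' : V ⟶ A), a ≫ h = a' ≫ h → Linked f g a a'
  linked_right : ∀ ⦃V : C⦄ (b b' : V ⟶ B), b ≫ i = b' ≫ i → Linked g f b b'

lemma Linked.comp_eq {R A B V T : C} {f : R ⟶ A} {g : R ⟶ B} {a a' : V ⟶ A}
    (H : Linked f g a a') {u : A ⟶ T} {v : B ⟶ T} (huv : f ≫ u = g ≫ v) : a ≫ u = a' ≫ u := by
  refine Locally.hom_ext (H.mono ?_)
  rintro U k (hk | ⟨r, r', hr, hr', hg⟩)
  · simp only [← Category.assoc, hk]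
  · simp only [← Category.assoc, ← hr, ← hr']
    simp only [Category.assoc, huv]
    simp only [← Category.assoc, hg]

namespace IsLocallyExact

variable {R A B P : C} {f : R ⟶ A} {g : R ⟶ B} {h : A ⟶ P} {i : B ⟶ P}

lemma isPushout (H : IsLocallyExact f g h i) : IsPushout f g h i := by
  refine .mk' H.w (fun T φ φ' e e' ↦ ?_) fun T u v e ↦ ?_
  · refine Locally.hom_ext ((H.locally_lift (𝟙 P)).mono ?_)
    rintro U k (⟨a, ha⟩ | ⟨b, hb⟩)
    · obtain rfl : a ≫ h = k := by simpa using ha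
      simp [e]
    · obtain rfl : b ≫ i = k := by simpa using hb
      simp [e']
  have hA : ∀ ⦃U : C⦄ (a a' : U ⟶ A), a ≫ h = a' ≫ h → a ≫ u = a' ≫ u :=
    fun U a a' he ↦ (H.linked_left a a' he).comp_eq e
  have hB : ∀ ⦃U : C⦄ (b b' : U ⟶ B), b ≫ i = b' ≫ i → b ≫ v = b' ≫ v :=
    fun U b b' he ↦ (H.linked_right b b' he).comp_eq e.symm
  have hAB : ∀ ⦃U : C⦄ (a : U ⟶ A) (b : U ⟶ B), a ≫ h = b ≫ i → a ≫ u = b ≫ v := by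
    intro U a b he
    refine Locally.hom_ext ((H.locally_exists a b he).mono ?_)
    rintro W k ⟨r, hr, hr'⟩
    rw [← Category.assoc, ← Category.assoc, ← hr, ← hr', Category.assoc, Category.assoc, e]
  obtain ⟨t, ht⟩ := Locally.glue (V := P) (T := T)
    (fun U k t ↦ (∃ a, a ≫ h = k ∧ a ≫ u = t) ∨ ∃ b, b ≫ i = k ∧ b ≫ v = t)
    (by
      rintro U W l k t (⟨a, rfl, rfl⟩ | ⟨b, rfl, rfl⟩)
      · exact .inl ⟨l ≫ a, by simp, by simp⟩
      · exact .inr ⟨l ≫ b, by simp, by simp⟩)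
    (by
      rintro U k t t' (⟨a, rfl, rfl⟩ | ⟨b, rfl, rfl⟩) (⟨a', h', rfl⟩ | ⟨b', h', rfl⟩)
      · exact hA _ _ h'.symm
      · exact hAB _ _ h'.symm
      · exact (hAB _ _ h').symm
      · exact hB _ _ h'.symm)
    ((H.locally_lift (𝟙 P)).mono (by
      rintro U k (⟨a, ha⟩ | ⟨b, hb⟩)
      · exact ⟨_, .inl ⟨a, by simpa using ha, rfl⟩⟩
      · exact ⟨_, .inr ⟨b, by simpa using hb, rfl⟩⟩))
  refine ⟨t, ?_, ?_⟩
  · refine Locally.hom_ext ((ht.restrict h).mono ?_)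
    rintro U k (⟨a, ha, ha'⟩ | ⟨b, hb, hb'⟩)
    · exact (Category.assoc _ _ _).symm.trans (ha'.symm.trans (hA _ _ ha))
    · exact (Category.assoc _ _ _).symm.trans (hb'.symm.trans (hAB _ _ hb.symm).symm)
  · refine Locally.hom_ext ((ht.restrict i).mono ?_)
    rintro U k (⟨a, ha, ha'⟩ | ⟨b, hb, hb'⟩)
    · exact (Category.assoc _ _ _).symm.trans (ha'.symm.trans (hAB _ _ ha))
    · exact (Category.assoc _ _ _).symm.trans (hb'.symm.trans (hB _ _ hb))

lemma of_isPullback (H : IsLocallyExact f g h i) {R' A' B' P' : C} {f' : R' ⟶ A'} {g' : R' ⟶ B'}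
    {h' : A' ⟶ P'} {i' : B' ⟶ P'} {w : R' ⟶ R} {x : A' ⟶ A} {y : B' ⟶ B} {t : P' ⟶ P}
    (sq : CommSq f' g' h' i') (hh : IsPullback h' x t h) (hi : IsPullback i' y t i)
    (hf : IsPullback f' w x f) (hg : IsPullback g' w y g) : IsLocallyExact f' g' h' i' where
  w := sq.w
  locally_lift V p := (H.locally_lift (p ≫ t)).mono (by
    rintro U k (⟨a, ha⟩ | ⟨b, hb⟩)
    · obtain ⟨l, hl, -⟩ := hh.exists_lift (k ≫ p) a (by simp [ha])
      exact .inl ⟨l, hl⟩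
    · obtain ⟨l, hl, -⟩ := hi.exists_lift (k ≫ p) b (by simp [hb])
      exact .inr ⟨l, hl⟩)
  locally_exists V a b e := (H.locally_exists (a ≫ x) (b ≫ y)
      (by simp [← hh.w, ← hi.w, reassoc_of% e])).mono (by
    rintro U k ⟨r, hr, hr'⟩
    obtain ⟨l, hl, hl'⟩ := hf.exists_lift (k ≫ a) r (by simp [hr])
    refine ⟨l, hl, hi.hom_ext ?_ ?_⟩
    · rw [Category.assoc, ← sq.w, reassoc_of% hl, e, Category.assoc]
    · rw [Category.assoc, hg.w, reassoc_of% hl', hr', Category.assoc])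
  linked_left V a a' e := (H.linked_left (a ≫ x) (a' ≫ x)
      (by simp [← hh.w, reassoc_of% e])).mono (by
    rintro U k (hk | ⟨r, r', hr, hr', hrr'⟩)
    · exact .inl (hh.hom_ext (by simp [e]) (by simpa using hk))
    · obtain ⟨l, hl, hlr⟩ := hf.exists_lift (k ≫ a) r (by simp [hr])
      obtain ⟨l', hl', hlr'⟩ := hf.exists_lift (k ≫ a') r' (by simp [hr'])
      refine .inr ⟨l, l', hl, hl', hi.hom_ext ?_ ?_⟩
      · rw [Category.assoc, Category.assoc, ← sq.w, reassoc_of% hl, reassoc_of% hl', e]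
      · rw [Category.assoc, Category.assoc, hg.w, reassoc_of% hlr, reassoc_of% hlr', hrr'])
  linked_right V b b' e := (H.linked_right (b ≫ y) (b' ≫ y)
      (by simp [← hi.w, reassoc_of% e])).mono (by
    rintro U k (hk | ⟨r, r', hr, hr', hrr'⟩)
    · exact .inl (hi.hom_ext (by simp [e]) (by simpa using hk))
    · obtain ⟨l, hl, hlr⟩ := hg.exists_lift (k ≫ b) r (by simp [hr])
      obtain ⟨l', hl', hlr'⟩ := hg.exists_lift (k ≫ b') r' (by simp [hr'])
      refine .inr ⟨l, l', hl, hl', hh.hom_ext ?_ ?_⟩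
      · rw [Category.assoc, Category.assoc, sq.w, reassoc_of% hl, reassoc_of% hl', e]
      · rw [Category.assoc, Category.assoc, hf.w, reassoc_of% hlr, reassoc_of% hlr', hrr'])

lemma isStablePushout (H : IsLocallyExact f g h i) : IsStablePushout f g h i where
  isPushout := H.isPushout
  isPushout_of_isPullback _ _ _ _ _ _ _ _ _ _ _ _ sq hh hi hf hg :=
    (H.of_isPullback sq hh hi hf hg).isPushout

lemma isPullback (H : IsLocallyExact f g h i) (hm : JointlyMono₂ f g) : IsPullback f g h i := by
  refine .mk' H.w (fun T a b e e' ↦ hm.right_cancellation a b e e') fun T a b e ↦ ?_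
  obtain ⟨r, hr⟩ := Locally.glue (fun U k (r : U ⟶ R) ↦ r ≫ f = k ≫ a ∧ r ≫ g = k ≫ b)
    (by
      rintro U W l k r ⟨hf, hg⟩
      simp [hf, hg])
    (fun U k r r' hr hr' ↦
      hm.right_cancellation r r' (hr.1.trans hr'.1.symm) (hr.2.trans hr'.2.symm))
    (H.locally_exists a b e)
  exact ⟨r, Locally.hom_ext (hr.mono fun U k hk ↦ by simpa using hk.1),
    Locally.hom_ext (hr.mono fun U k hk ↦ by simpa using hk.2)⟩

lemma of_iso (H : IsLocallyExact f g h i) {P' : C} (e : P ≅ P') :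
    IsLocallyExact f g (h ≫ e.hom) (i ≫ e.hom) :=
  -- The new square is the pullback of the given one along `e.inv`.
  H.of_isPullback (w := 𝟙 R) (x := 𝟙 A) (y := 𝟙 B) (t := e.inv) ⟨by simp [reassoc_of% H.w]⟩
    (.of_vert_isIso ⟨by simp⟩) (.of_vert_isIso ⟨by simp⟩) (.of_vert_isIso ⟨by simp⟩)
    (.of_vert_isIso ⟨by simp⟩)

lemma hasExactPushout (H : IsLocallyExact f g h i) (hm : JointlyMono₂ f g) :
    HasExactPushout f g := by
  have key : ∀ ⦃Z : C⦄ (h' : A ⟶ Z) (i' : B ⟶ Z), IsPushout f g h' i' →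
      IsLocallyExact f g h' i' := fun Z h' i' H' ↦ by
    simpa using H.of_iso (H.isPushout.isoIsPushout _ _ H')
  exact ⟨H.isPushout.hasPushout, fun Z h' i' H' ↦ (key h' i' H').isStablePushout,
    fun Z h' i' H' ↦ (key h' i' H').isPullback hm⟩

end IsLocallyExact

/-! ### Pushouts of Mal'cev spans in Barr-exact amalgamable categories -/

namespace Linked

variable {R A B V : C} {f : R ⟶ A} {g : R ⟶ B}

lemma refl (a : V ⟶ A) : Linked f g a a :=
  .of_forall fun _ _ ↦ .inl rfl

lemma symm {a a' : V ⟶ A} (H : Linked f g a a') : Linked f g a' a :=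
  H.mono fun _ _ hk ↦ hk.imp Eq.symm fun ⟨r, r', hr, hr', e⟩ ↦ ⟨r', r, hr', hr, e.symm⟩

/-- If `a, a'` are related by `(r, r')` and `a', a''` by `(s, s')`, then `a, a''` are related by
`(m, s')`, with `m` the value of the Mal'cev operation at `(r, r', s)`. -/
lemma trans [HasPullbacks C] (hR : IsMalcevSpan f g) {a a' a'' : V ⟶ A} (H : Linked f g a a')
    (H' : Linked f g a' a'') : Linked f g a a'' := by
  refine H.bind fun U k hk ↦ (H'.restrict k).mono fun W l hl ↦ ?_
  simp only [Category.assoc] at hl ⊢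
  rcases hk with hk | ⟨r, r', hr, hr', e⟩
  · rwa [hk]
  · rcases hl with hl | ⟨s, s', hs, hs', e'⟩
    · exact .inr ⟨l ≫ r, l ≫ r', by simp [hr], by simp [hr', hl], by simp [e]⟩
    · obtain ⟨m, hm, hm'⟩ := hR.exists_of_eq (l ≫ r) (l ≫ r') s (by simp [e])
        (by simp [hr', hs])
      exact .inr ⟨m, s', by simp [hm, hr], hs', hm'.trans e'⟩

/-- The relations that a Mal'cev span `A ⟵ R ⟶ B` induces on `A` and on `B` restrict to the same
relation on `R`. -/
lemma swap [HasPullbacks C] (hR : IsMalcevSpan f g) {r r' : V ⟶ R}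
    (H : Linked f g (r ≫ f) (r' ≫ f)) : Linked g f (r ≫ g) (r' ≫ g) := by
  refine H.mono fun U k hk ↦ .inr ?_
  rcases hk with hk | ⟨s, s', hs, hs', e⟩
  · exact ⟨k ≫ r, k ≫ r', by simp, by simp, by simpa using hk⟩
  · obtain ⟨m, hm, hm'⟩ := hR.flip.exists_of_eq (k ≫ r) s s' (by simp [hs]) e
    exact ⟨m, k ≫ r', by simp [hm], by simp, by simp [hm', hs']⟩

end Linked

section Amalgam

variable [HasPullbacks C] {W X Y Z : C} {f : W ⟶ X} {g : W ⟶ Y} {h : X ⟶ Z} {i : Y ⟶ Z}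

/-- If a stable pushout is a pullback and `f` is a monomorphism, then so is `i`. -/
lemma IsStablePushout.mono_inr [Mono f] (H : IsStablePushout f g h i)
    (H' : IsPullback f g h i) : Mono i := by
  have hk := IsKernelPair.of_hasPullback i
  obtain ⟨l, hl, hl'⟩ := hk.exists_lift g g rfl
  -- Pulling the square back along `i` turns `f` into an isomorphism, and `i` into one of the
  -- projections of its kernel pair.
  have hg : IsPullback l (𝟙 W) (pullback.snd i i) g := by
    refine .mk' (by simp [hl']) (fun T a b _ e ↦ by simpa using e) fun T a b e ↦ ?_
    obtain ⟨w, hw, hw'⟩ := H'.exists_lift (b ≫ f) (a ≫ pullback.fst i i) (by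
      rw [Category.assoc, Category.assoc, H'.w, hk.w, reassoc_of% e])
    obtain rfl := (cancel_mono f).1 hw
    exact ⟨w, hk.hom_ext (by simpa [hl] using hw') (by simpa [hl'] using e.symm), by simp⟩
  have hpo := H.isPushout_of_isPullback (𝟙 W) l g (pullback.fst i i) (𝟙 W) f (pullback.snd i i) i
    ⟨by simp [hl]⟩ H'.flip hk (IsKernelPair.id_of_mono f) hg
  have := hpo.isIso_inr_of_isIso
  exact hk.mono_of_isIso_fst

/-- Unions are effective: the pushout of the intersection of two subobjects is a subobject. -/
lemma IsStablePushout.mono_of_isPullback (H : IsStablePushout f g h i) {T : C} {a : X ⟶ T}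
    {b : Y ⟶ T} [Mono a] [Mono b] (hab : IsPullback f g a b) {t : Z ⟶ T} (ht : h ≫ t = a)
    (ht' : i ≫ t = b) : Mono t := by
  -- Locally, each of two elements `p`, `q` of `Z` with the same image in `T` comes from `X` or `Y`.
  refine ⟨fun {V} p q e ↦ Locally.hom_ext ?_⟩
  refine (H.locally_lift p).bind fun U k hk ↦ (H.locally_lift (k ≫ q)).mono fun U' l hl ↦ ?_
  have e' : l ≫ (k ≫ p) ≫ t = (l ≫ k ≫ q) ≫ t := by simp [e]
  have cross : ∀ (x : U' ⟶ X) (y : U' ⟶ Y), x ≫ a = y ≫ b → x ≫ h = y ≫ i := by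
    intro x y hxy
    obtain ⟨w, rfl, rfl⟩ := hab.exists_lift x y hxy
    simp [H.isPushout.w]
  simp only [Category.assoc l k]
  rcases hk with ⟨x, hx⟩ | ⟨y, hy⟩ <;> rcases hl with ⟨x', hx'⟩ | ⟨y', hy'⟩
  · rw [← hx, ← hx'] at e' ⊢
    simp only [Category.assoc, ht] at e'
    rw [← (cancel_mono a).1 ((Category.assoc _ _ _).trans e'), Category.assoc]
  · rw [← hx, ← hy'] at e' ⊢
    simp only [Category.assoc, ht, ht'] at e'
    rw [← Category.assoc]
    exact cross _ _ (by simpa using e')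
  · rw [← hy, ← hx'] at e' ⊢
    simp only [Category.assoc, ht, ht'] at e'
    rw [← Category.assoc]
    exact (cross _ _ (by simpa using e'.symm)).symm
  · rw [← hy, ← hy'] at e' ⊢
    simp only [Category.assoc, ht'] at e'
    rw [← (cancel_mono b).1 ((Category.assoc _ _ _).trans e'), Category.assoc]

end Amalgam

lemma exists_isRegularEpi_mono_fac [Regular C] {X Y : C} (p : X ⟶ Y) :
    ∃ (I : C) (e : X ⟶ I) (m : I ⟶ Y), IsRegularEpi e ∧ Mono m ∧ e ≫ m = p :=
  let F := Regular.strongEpiMonoFactorisation p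
  ⟨F.I, F.e, F.m, inferInstanceAs (IsRegularEpi (Regular.strongEpiMonoFactorisation p).e),
    F.m_mono, F.fac⟩

/-- Two morphisms with the same kernel pair have the same image. -/
lemma exists_common_image [Regular C] {R P P' : C} (p : R ⟶ P) (p' : R ⟶ P')
    (h : ∀ ⦃V : C⦄ (r r' : V ⟶ R), r ≫ p = r' ≫ p ↔ r ≫ p' = r' ≫ p') :
    ∃ (Q : C) (e : R ⟶ Q) (m : Q ⟶ P) (m' : Q ⟶ P'), IsRegularEpi e ∧ Mono m ∧ Mono m' ∧
      e ≫ m = p ∧ e ≫ m' = p' := by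
  obtain ⟨Q, q, m, hq, hm, rfl⟩ := exists_isRegularEpi_mono_fac p
  have hw : IsRegularEpi.left q ≫ p' = IsRegularEpi.right q ≫ p' := by
    rw [← h, ← Category.assoc, IsRegularEpi.w, Category.assoc]
  refine ⟨_, q, m, IsRegularEpi.desc q p' hw, hq, hm, ⟨fun {V} a b e ↦ ?_⟩, rfl,
    IsRegularEpi.fac q p' hw⟩
  refine Locally.hom_ext ((locally_lift_of_isRegularEpi q a).bind fun U k ⟨x, hx⟩ ↦
    (locally_lift_of_isRegularEpi q (k ≫ b)).mono fun U' l ⟨y, hy⟩ ↦ ?_)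
  have hxy : (l ≫ x) ≫ p' = y ≫ p' := by
    rw [← IsRegularEpi.fac q p' hw, Category.assoc, reassoc_of% hx, reassoc_of% hy, e]
  rw [← h] at hxy
  simp only [← Category.assoc, cancel_mono] at hxy
  rw [Category.assoc, Category.assoc, ← hx, ← hy, ← hxy, Category.assoc]

/-- The relation `Linked f g` is represented by a subobject of `A ⨯ A`, the union of the diagonal
and of the image of `R ×_B R`. -/
lemma IsAmalgamable.exists_linked_representation [Regular C] (H : IsAmalgamable C) {R A B : C}
    (f : R ⟶ A) (g : R ⟶ B) :
    ∃ (E : C) (s t : E ⟶ A), JointlyMono₂ s t ∧ ∀ ⦃V : C⦄ (a a' : V ⟶ A),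
      (∃ e, e ≫ s = a ∧ e ≫ t = a') ↔ Linked f g a a' := by
  have hR := IsPullback.of_hasPullback g g
  let n := prod.lift (pullback.fst g g ≫ f) (pullback.snd g g ≫ f)
  obtain ⟨I, q, m, hq, hm, hqm⟩ := exists_isRegularEpi_mono_fac n
  let d := diag A
  have hW := IsPullback.of_hasPullback d m
  have hpo := H (pullback.fst d m) (pullback.snd d m) inferInstance inferInstance
  have := hpo.hasPushout
  have hp := IsPushout.of_hasPushout (pullback.fst d m) (pullback.snd d m)
  have hst := hpo.isStablePushout _ _ hp
  obtain ⟨t, ht, ht'⟩ := hp.exists_desc d m hW.w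
  have := hst.mono_of_isPullback hW ht ht'
  have hext : ∀ ⦃V : C⦄ (a b : V ⟶ A ⨯ A), a ≫ prod.fst = b ≫ prod.fst →
      a ≫ prod.snd = b ≫ prod.snd → a = b := fun V a b h h' ↦ Limits.prod.hom_ext h h'
  have ht₁ : pushout.inl _ _ ≫ t ≫ prod.fst = 𝟙 A := by rw [reassoc_of% ht, prod.lift_fst]
  have ht₂ : pushout.inl _ _ ≫ t ≫ prod.snd = 𝟙 A := by rw [reassoc_of% ht, prod.lift_snd]
  have hn₁ : q ≫ m ≫ prod.fst = pullback.fst g g ≫ f := by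
    rw [← Category.assoc, hqm, prod.lift_fst]
  have hn₂ : q ≫ m ≫ prod.snd = pullback.snd g g ≫ f := by
    rw [← Category.assoc, hqm, prod.lift_snd]
  refine ⟨_, t ≫ prod.fst, t ≫ prod.snd, ⟨fun V a b h h' ↦ ?_⟩, fun V a a' ↦ ⟨?_, fun h ↦ ?_⟩⟩
  · exact (cancel_mono t).1 (hext _ _ (by simpa using h) (by simpa using h'))
  · rintro ⟨e, rfl, rfl⟩
    refine (hst.locally_lift e).bind fun U k hk ↦ ?_
    rcases hk with ⟨x, hx⟩ | ⟨y, hy⟩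
    · refine .of_forall fun W l ↦ .inl ?_
      have h₁ : k ≫ e ≫ t ≫ prod.fst = x := by rw [← reassoc_of% hx, ht₁, Category.comp_id]
      have h₂ : k ≫ e ≫ t ≫ prod.snd = x := by rw [← reassoc_of% hx, ht₂, Category.comp_id]
      rw [Category.assoc, Category.assoc, h₁, h₂]
    · refine (locally_lift_of_isRegularEpi q y).mono fun W l ⟨z, hz⟩ ↦
        .inr ⟨z ≫ pullback.fst g g, z ≫ pullback.snd g g, ?_, ?_, ?_⟩
      · rw [Category.assoc, Category.assoc, ← reassoc_of% hy, reassoc_of% ht',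
          ← reassoc_of% hz, hn₁]
      · rw [Category.assoc, Category.assoc, ← reassoc_of% hy, reassoc_of% ht',
          ← reassoc_of% hz, hn₂]
      · rw [Category.assoc, Category.assoc, hR.w]
  · obtain ⟨e, he⟩ := Locally.exists_factor (a := prod.lift a a') (m := t) (h.mono (by
      rintro U k (hk | ⟨r, r', hr, hr', e⟩)
      · refine ⟨(k ≫ a) ≫ pushout.inl _ _, hext _ _ ?_ ?_⟩
        · rw [Category.assoc, Category.assoc, Category.assoc, ht₁, Category.assoc, prod.lift_fst,
            Category.comp_id]
        · rw [Category.assoc, Category.assoc, Category.assoc, ht₂, Category.assoc, prod.lift_snd,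
            Category.comp_id, hk]
      · obtain ⟨l, rfl, rfl⟩ := hR.exists_lift r r' e
        refine ⟨(l ≫ q) ≫ pushout.inr _ _, hext _ _ ?_ ?_⟩
        · rw [Category.assoc, Category.assoc, Category.assoc, reassoc_of% ht', hn₁, Category.assoc,
            prod.lift_fst, ← hr, Category.assoc]
        · rw [Category.assoc, Category.assoc, Category.assoc, reassoc_of% ht', hn₂, Category.assoc,
            prod.lift_snd, ← hr', Category.assoc]))
    exact ⟨e, by rw [reassoc_of% he, prod.lift_fst], by rw [reassoc_of% he, prod.lift_snd]⟩

section FiniteLimits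

variable [HasFiniteLimits C]

/-- For a Mal'cev span, `Linked f g` is an equivalence relation, so it has a quotient. -/
lemma IsBarrExact.exists_linked_quotient (H : IsBarrExact C) (H' : IsAmalgamable C) {R A B : C}
    {f : R ⟶ A} {g : R ⟶ B} (hR : IsMalcevSpan f g) :
    ∃ (P : C) (q : A ⟶ P), IsRegularEpi q ∧ ∀ ⦃V : C⦄ (a a' : V ⟶ A),
      a ≫ q = a' ≫ q ↔ Linked f g a a' := by
  have := H.regular
  obtain ⟨E, s, t, hst, hE⟩ := H'.exists_linked_representation f g
  obtain ⟨r, hr, hr'⟩ := (hE (𝟙 A) (𝟙 A)).2 (.refl _)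
  obtain ⟨σ, hσ, hσ'⟩ := (hE t s).2 ((hE s t).1 ⟨𝟙 E, by simp, by simp⟩).symm
  have hE' := IsPullback.of_hasPullback t s
  obtain ⟨τ, hτ, hτ'⟩ := (hE (pullback.fst t s ≫ s) (pullback.snd t s ≫ t)).2
    (((hE _ _).1 ⟨pullback.fst t s, rfl, rfl⟩).trans hR
      ((hE _ _).1 ⟨pullback.snd t s, hE'.w.symm, rfl⟩))
  obtain ⟨P, q, hq⟩ := H.isKernelPair s t
    ⟨⟨{ toJointlyMono₂ := hst, r := r, s := σ, c := _, isLimit := pullbackIsPullback t s, t := τ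
        reflexivity₁ := hr, reflexivity₂ := hr', symmetry₁ := hσ, symmetry₂ := hσ'
        transitivity₁ := hτ, transitivity₂ := hτ' }⟩⟩
  obtain ⟨Q, e, m, he, hm, rfl⟩ := exists_isRegularEpi_mono_fac q
  have he' : IsKernelPair e s t := hq.cancel_right_of_mono
  refine ⟨Q, e, he, fun V a a' ↦ ?_⟩
  rw [← hE]
  refine ⟨fun h ↦ he'.exists_lift a a' h, ?_⟩
  rintro ⟨e, rfl, rfl⟩
  simp [he'.w]

/-- In a Barr-exact amalgamable category, the pushout of a Mal'cev span `A ⟵ R ⟶ B` is obtained by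
amalgamating the quotients of `A` and `B` by the relations induced by `R` along the common image of
`R` in them. -/
lemma IsBarrExact.isDiexact (H : IsBarrExact C) (H' : IsAmalgamable C) : IsDiexact C := by
  intro R A B f g hR
  have := H.regular
  obtain ⟨P₁, q₁, hq₁, hA⟩ := H.exists_linked_quotient H' hR
  obtain ⟨P₂, q₂, hq₂, hB⟩ := H.exists_linked_quotient H' hR.flip
  obtain ⟨Q, e, m₁, m₂, he, hm₁, hm₂, hf, hg⟩ := exists_common_image (f ≫ q₁) (g ≫ q₂)
    (fun V r r' ↦ by
      simp only [← Category.assoc, hA, hB]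
      exact ⟨fun h ↦ h.swap hR, fun h ↦ h.swap hR.flip⟩)
  have hpo := H' m₁ m₂ hm₁ hm₂
  have := hpo.hasPushout
  obtain ⟨P, j₁, j₂, hp⟩ : ∃ (P : C) (j₁ : P₁ ⟶ P) (j₂ : P₂ ⟶ P), IsPushout m₁ m₂ j₁ j₂ :=
    ⟨_, _, _, .of_hasPushout m₁ m₂⟩
  have hst := hpo.isStablePushout _ _ hp
  have hpb := hpo.isPullback _ _ hp
  have hst' : IsStablePushout m₂ m₁ j₂ j₁ := (H' m₂ m₁ hm₂ hm₁).isStablePushout _ _ hp.flip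
  have hj₂ : Mono j₂ := hst.mono_inr hpb
  have hj₁ : Mono j₁ := hst'.mono_inr hpb.flip
  suffices IsLocallyExact f g (q₁ ≫ j₁) (q₂ ≫ j₂) from this.hasExactPushout hR.jointlyMono
  refine ⟨?_, fun V p ↦ ?_, fun V a b h ↦ ?_, fun V a a' h ↦ ?_, fun V b b' h ↦ ?_⟩
  · rw [← Category.assoc, ← Category.assoc, ← hf, ← hg, Category.assoc, Category.assoc, hp.w]
  · refine (hst.locally_lift p).bind fun U k hk ↦ ?_
    rcases hk with ⟨x, hx⟩ | ⟨y, hy⟩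
    · exact (locally_lift_of_isRegularEpi q₁ x).mono fun W l ⟨a, ha⟩ ↦
        .inl ⟨a, by rw [reassoc_of% ha, hx, Category.assoc]⟩
    · exact (locally_lift_of_isRegularEpi q₂ y).mono fun W l ⟨b, hb⟩ ↦
        .inr ⟨b, by rw [reassoc_of% hb, hy, Category.assoc]⟩
  · -- The element `r` lifts the common image of `a` and `b` in `Q`; it is then corrected twice,
    -- to `s'` with `s' ≫ f = a`, and to `m` with moreover `m ≫ g = b`.
    obtain ⟨c, hc, hc'⟩ := hpb.exists_lift (a ≫ q₁) (b ≫ q₂) (by simpa using h)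
    have step₁ : Locally fun U (k : U ⟶ V) ↦ ∃ s' : U ⟶ R, s' ≫ f = k ≫ a ∧
        s' ≫ g ≫ q₂ = k ≫ b ≫ q₂ := by
      refine (locally_lift_of_isRegularEpi e c).bind fun U k ⟨r, hr⟩ ↦ ?_
      have h₁ : (r ≫ f) ≫ q₁ = (k ≫ a) ≫ q₁ := by
        rw [Category.assoc, ← hf, reassoc_of% hr, hc, Category.assoc]
      have h₂ : (r ≫ g) ≫ q₂ = (k ≫ b) ≫ q₂ := by
        rw [Category.assoc, ← hg, reassoc_of% hr, hc', Category.assoc]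
      refine ((hA _ _).1 h₁).mono fun W l hl ↦ ?_
      rcases hl with hl | ⟨s, s', hs, hs', hss⟩
      · exact ⟨l ≫ r, by simpa using hl, by simpa using l ≫= h₂⟩
      · refine ⟨s', by simpa using hs', ?_⟩
        have h₃ : (s' ≫ g) ≫ q₂ = (l ≫ r ≫ g) ≫ q₂ := (hB _ _).2 <| .of_forall fun _ k' ↦
          .inr ⟨k' ≫ s, k' ≫ l ≫ r, by simp [hss], by simp, by simp [hs]⟩
        simpa using h₃.trans (by simpa using l ≫= h₂)
    refine step₁.bind fun U k ⟨s, hs, hs'⟩ ↦ ?_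
    refine ((hB (s ≫ g) (k ≫ b)).1 (by simpa using hs')).mono fun W l hl ↦ ?_
    rcases hl with hl | ⟨t, t', ht, ht', htt⟩
    · exact ⟨l ≫ s, by simp [hs], by simpa using hl⟩
    · obtain ⟨m, hm, hm'⟩ := hR.exists_of_eq (l ≫ s) t t' (by simp [ht]) htt
      exact ⟨m, by simp [hm, hs], by simp [hm', ht']⟩
  · exact (hA a a').1 ((cancel_mono j₁).1 (by simpa using h))
  · exact (hB b b').1 ((cancel_mono j₂).1 (by simpa using h))

end FiniteLimits

end Exactness


theorem theorem2 (C : Type u) [Category.{v} C] [HasFiniteLimits C] :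
    List.TFAE
      [Exactness.IsDiexact C,
        Exactness.IsBarrExact C ∧ Exactness.IsAdhesive C,
        Exactness.IsBarrExact C ∧ Exactness.IsAmalgamable C] := by
  tfae_have 1 → 2 := fun h ↦ ⟨h.isBarrExact, h.isAdhesive⟩
  tfae_have 2 → 3 := fun h ↦ ⟨h.1, fun _ _ _ f g hf _ ↦ h.2 f g hf⟩
  tfae_have 3 → 1 := fun h ↦ h.1.isDiexact h.2
  tfae_finish
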